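/- All vector spaces are over $\mathbb{C}$, and algebras are associative but not necessarily unital. Let $H$ be a complex Hilbert space, let $H\hat\otimes_2 H$ be its Hilbertian tensor square (the completion of the algebraic tensor product for $\langle a\otimes b,c\otimes d\rangle=\langle a,c\rangle\langle b,d\rangle$), and let $\mu\colon H\hat\otimes_2 H\to H$ be a bounded linear map. Write $uv=\mu(u\otimes v)$, let $\mu^\dagger$ be the Hilbert adjoint of $\mu$, and let $\alpha\colon (H\hat\otimes_2 H)\hat\otimes_2 H\to H\hat\otimes_2(H\hat\otimes_2 H)$ be the unitary associativity isomorphism. Suppose that $(H,\mu)$ is a commutative Hilbertian Frobenius algebra, that is, $\mu$ is associative and commutative and satisfies the Frobenius condition $$(\mu\hat\otimes_2 \mathrm{id})\circ\alpha^{-1}\circ(\mathrm{id}\hat\otimes_2\mu^\dagger)=\mu^\dagger\circ\mu=(\mathrm{id}\hat\otimes_2\mu)\circ\alpha\circ(\mu^\dagger\hat\otimes_2\mathrm{id}).$$ Then for each $u\in H$ the multiplication operator $M_u\colon H\to H$, $M_u(v)=uv$, is normal: $M_u\circ M_u^\dagger=M_u^\dagger\circ M_u$. In particular $J(H,\mu)=A(H,\mu)$,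 where $J(H,\mu)$ is the Jacobson radical of the algebra $H$ (the intersection of all its maximal modular ideals, equal to $H$ if there are none; an ideal $I$ is modular if there is $e\in H$ with $x-xe\in I$ for all $x\in H$), and $A(H,\mu)=\{u\in H: uv=0 \text{ for all } v\in H\}$ is the annihilator. -/

import Mathlib

open scoped TensorProduct

namespace HilbFrob

noncomputable section

/-- The Hilbertian tensor product of two Hilbert spaces: the completion of the algebraic tensor
product for the inner product with `⟪a ⊗ b, c ⊗ d⟫ = ⟪a, c⟫ * ⟪b, d⟫`. -/
abbrev HTensor (H K : Type*) [NormedAddCommGroup H] [InnerProductSpace ℂ H]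
    [NormedAddCommGroup K] [InnerProductSpace ℂ K] : Type _ :=
  UniformSpace.Completion (H ⊗[ℂ] K)

section Tensor

variable {H K L H' K' : Type*}
  [NormedAddCommGroup H] [InnerProductSpace ℂ H]
  [NormedAddCommGroup K] [InnerProductSpace ℂ K]
  [NormedAddCommGroup L] [InnerProductSpace ℂ L]
  [NormedAddCommGroup H'] [InnerProductSpace ℂ H']
  [NormedAddCommGroup K'] [InnerProductSpace ℂ K']

/-- The elementary tensor `x ⊗ y` in the Hilbertian tensor product. -/
def htmul (x : H) (y : K) : HTensor H K := ((x ⊗ₜ[ℂ] y : H ⊗[ℂ] K) : HTensor H K)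

/-- The tensor product `f ⊗ g` of two bounded linear maps. -/
def hmap (f : H →L[ℂ] H') (g : K →L[ℂ] K') : HTensor H K →L[ℂ] HTensor H' K' :=
  (TensorProduct.mapL f g).completion

theorem hmap_htmul (f : H →L[ℂ] H') (g : K →L[ℂ] K') (x : H) (y : K) :
    hmap f g (htmul x y) = htmul (f x) (g y) := by
  simp [hmap, htmul]

/-- The symmetry `x ⊗ y ↦ y ⊗ x`. -/
def hswap (H K : Type*) [NormedAddCommGroup H] [InnerProductSpace ℂ H]
    [NormedAddCommGroup K] [InnerProductSpace ℂ K] : HTensor H K →L[ℂ] HTensor K H :=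
  ((TensorProduct.commIsometry ℂ H K).toContinuousLinearEquiv :
    (H ⊗[ℂ] K) →L[ℂ] (K ⊗[ℂ] H)).completion

theorem hswap_htmul (x : H) (y : K) : hswap H K (htmul x y) = htmul y x := by
  simp [hswap, htmul]

/-- The canonical isometric embedding of the algebraic tensor product `(H ⊗ K) ⊗ L` into the
iterated Hilbertian tensor product. -/
def leftEmb (H K L : Type*) [NormedAddCommGroup H] [InnerProductSpace ℂ H]
    [NormedAddCommGroup K] [InnerProductSpace ℂ K]
    [NormedAddCommGroup L] [InnerProductSpace ℂ L] :
    (H ⊗[ℂ] K) ⊗[ℂ] L →ₗᵢ[ℂ] HTensor (HTensor H K) L :=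
  UniformSpace.Completion.toComplₗᵢ.comp
    (TensorProduct.mapIsometry UniformSpace.Completion.toComplₗᵢ LinearIsometry.id)

/-- The canonical isometric embedding of the algebraic tensor product `H ⊗ (K ⊗ L)` into the
iterated Hilbertian tensor product. -/
def rightEmb (H K L : Type*) [NormedAddCommGroup H] [InnerProductSpace ℂ H]
    [NormedAddCommGroup K] [InnerProductSpace ℂ K]
    [NormedAddCommGroup L] [InnerProductSpace ℂ L] :
    H ⊗[ℂ] (K ⊗[ℂ] L) →ₗᵢ[ℂ] HTensor H (HTensor K L) :=
  UniformSpace.Completion.toComplₗᵢ.comp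
    (TensorProduct.mapIsometry LinearIsometry.id UniformSpace.Completion.toComplₗᵢ)

theorem leftEmb_tmul (x : H) (y : K) (z : L) :
    leftEmb H K L ((x ⊗ₜ[ℂ] y) ⊗ₜ[ℂ] z) = htmul (htmul x y) z := by
  simp [leftEmb, htmul]

theorem rightEmb_tmul (x : H) (y : K) (z : L) :
    rightEmb H K L (x ⊗ₜ[ℂ] (y ⊗ₜ[ℂ] z)) = htmul x (htmul y z) := by
  simp [rightEmb, htmul]

theorem denseRange_map (f : H →ₗᵢ[ℂ] H') (g : K →ₗᵢ[ℂ] K')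
    (hf : DenseRange f) (hg : DenseRange g) :
    DenseRange (TensorProduct.mapIsometry f g) := by
  have key : ∀ x : H' ⊗[ℂ] K',
      x ∈ (LinearMap.range (TensorProduct.mapIsometry f g).toLinearMap).topologicalClosure := by
    intro x
    induction x using TensorProduct.induction_on with
    | zero => exact Submodule.zero_mem _
    | add a b ha hb => exact Submodule.add_mem _ ha hb
    | tmul a b =>
      have hd : DenseRange (Prod.map f g) := hf.prodMap hg
      have hab : (a, b) ∈ closure (Set.range (Prod.map f g)) := hd (a, b)
      have hcont : Continuous fun p : H' × K' => p.1 ⊗ₜ[ℂ] p.2 :=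
        TensorProduct.continuous_tmul
      refine map_mem_closure (f := fun p : H' × K' => p.1 ⊗ₜ[ℂ] p.2) hcont hab ?_
      rintro _ ⟨⟨h, k⟩, rfl⟩
      exact ⟨h ⊗ₜ[ℂ] k, by simp⟩
  exact fun x => key x

theorem denseRange_leftEmb : DenseRange (leftEmb H K L) := by
  have h := denseRange_map (UniformSpace.Completion.toComplₗᵢ (𝕜 := ℂ) (E := H ⊗[ℂ] K))
    (LinearIsometry.id (R := ℂ) (E := L))
    UniformSpace.Completion.denseRange_coe Function.surjective_id.denseRange
  exact (UniformSpace.Completion.denseRange_coe).comp h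
    (UniformSpace.Completion.continuous_coe _)

theorem denseRange_rightEmb : DenseRange (rightEmb H K L) := by
  have h := denseRange_map (LinearIsometry.id (R := ℂ) (E := H))
    (UniformSpace.Completion.toComplₗᵢ (𝕜 := ℂ) (E := K ⊗[ℂ] L))
    Function.surjective_id.denseRange UniformSpace.Completion.denseRange_coe
  exact (UniformSpace.Completion.denseRange_coe).comp h
    (UniformSpace.Completion.continuous_coe _)

/-- The associativity constraint `(x ⊗ y) ⊗ z ↦ x ⊗ (y ⊗ z)`, as a unitary map: the continuous
extension of the associativity isomorphism of the algebraic tensor product. -/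
def hassoc (H K L : Type*) [NormedAddCommGroup H] [InnerProductSpace ℂ H]
    [NormedAddCommGroup K] [InnerProductSpace ℂ K]
    [NormedAddCommGroup L] [InnerProductSpace ℂ L] :
    HTensor (HTensor H K) L ≃ₗᵢ[ℂ] HTensor H (HTensor K L) :=
  (TensorProduct.assoc ℂ H K L).extendOfIsometry
    (leftEmb H K L).toLinearMap (rightEmb H K L).toLinearMap
    denseRange_leftEmb denseRange_rightEmb
    (fun x =>
      (LinearIsometry.norm_map (rightEmb H K L) _).trans
        (((TensorProduct.assocIsometry ℂ H K L).norm_map x).trans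
          (LinearIsometry.norm_map (leftEmb H K L) x).symm))

theorem hassoc_htmul (x : H) (y : K) (z : L) :
    hassoc H K L (htmul (htmul x y) z) = htmul x (htmul y z) := by
  rw [← leftEmb_tmul, ← rightEmb_tmul]
  exact LinearEquiv.extendOfIsometry_eq _ _ _ _ _ _ _

end Tensor

section Radical

variable {A : Type*} [AddCommGroup A] [Module ℂ A]

/-- A left ideal of the (not necessarily unital) algebra with multiplication `m`. -/
def IsLeftIdeal (m : A →ₗ[ℂ] A →ₗ[ℂ] A) (I : Submodule ℂ A) : Prop :=
  ∀ a : A, ∀ x ∈ I, m a x ∈ I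

/-- A modular left ideal: there is a right unit modulo `I`. -/
def IsModularLeftIdeal (m : A →ₗ[ℂ] A →ₗ[ℂ] A) (I : Submodule ℂ A) : Prop :=
  IsLeftIdeal m I ∧ ∃ e : A, ∀ x : A, x - m x e ∈ I

/-- A maximal modular left ideal: a modular left ideal which is maximal among the
proper left ideals. -/
def IsMaximalModularLeftIdeal (m : A →ₗ[ℂ] A →ₗ[ℂ] A) (I : Submodule ℂ A) : Prop :=
  IsModularLeftIdeal m I ∧ I ≠ ⊤ ∧
    ∀ I' : Submodule ℂ A, IsLeftIdeal m I' → I ≤ I' → I' ≠ ⊤ → I' = I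

/-- The Jacobson radical: the intersection of all maximal modular left ideals (the whole algebra
if there is none). -/
def jacobsonRadical (m : A →ₗ[ℂ] A →ₗ[ℂ] A) : Submodule ℂ A :=
  sInf {I | IsMaximalModularLeftIdeal m I}

/-- The annihilator `{u | ∀ v, u * v = 0}` of a commutative algebra. -/
def annihilator (m : A →ₗ[ℂ] A →ₗ[ℂ] A) : Submodule ℂ A where
  carrier := {u | ∀ v : A, m u v = 0}
  zero_mem' := fun v => by simp
  add_mem' := fun {a b} ha hb v => by simp [ha v, hb v]
  smul_mem' := fun c a ha v => by simp [ha v]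

end Radical

section Algebra

variable {H : Type*} [NormedAddCommGroup H] [InnerProductSpace ℂ H]

/-- The multiplication operator `M_u : v ↦ μ (u ⊗ v)`, as a bounded linear map depending
linearly and continuously on `u`. -/
def mulOp (μ : HTensor H H →L[ℂ] H) : H →L[ℂ] H →L[ℂ] H :=
  ContinuousLinearMap.compL ℂ H (H ⊗[ℂ] H) H
    (μ ∘L UniformSpace.Completion.toComplL) ∘L TensorProduct.mkL ℂ H H

theorem mulOp_apply (μ : HTensor H H →L[ℂ] H) (u v : H) : mulOp μ u v = μ (htmul u v) := rfl

/-- The underlying algebraic bilinear multiplication of `μ`. -/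
def mulBil (μ : HTensor H H →L[ℂ] H) : H →ₗ[ℂ] H →ₗ[ℂ] H := (mulOp μ).toLinearMap₁₂

theorem mulBil_apply (μ : HTensor H H →L[ℂ] H) (u v : H) : mulBil μ u v = μ (htmul u v) := rfl

/-- `(H, μ)` is a commutative semigroup object in the symmetric monoidal category of
Hilbert spaces. -/
structure IsHilbertianAlgebra (μ : HTensor H H →L[ℂ] H) : Prop where
  assoc : μ ∘L hmap μ (ContinuousLinearMap.id ℂ H) =
    (μ ∘L hmap (ContinuousLinearMap.id ℂ H) μ) ∘L
      (hassoc H H H).toContinuousLinearEquiv.toContinuousLinearMap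
  comm : μ ∘L hswap H H = μ

/-- `(H, μ)` is a commutative semigroup object in Hilbert spaces which satisfies the Frobenius
condition with respect to the Hilbert adjoint of the multiplication:
`(μ ⊗ id) ∘ α⁻¹ ∘ (id ⊗ μ†) = μ† ∘ μ = (id ⊗ μ) ∘ α ∘ (μ† ⊗ id)`. -/
structure IsHilbertianFrobeniusAlgebra [CompleteSpace H] (μ : HTensor H H →L[ℂ] H) : Prop
    extends IsHilbertianAlgebra μ where
  frobenius_left :
    hmap μ (ContinuousLinearMap.id ℂ H) ∘L
        (hassoc H H H).symm.toContinuousLinearEquiv.toContinuousLinearMap ∘L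
        hmap (ContinuousLinearMap.id ℂ H) (ContinuousLinearMap.adjoint μ) =
      ContinuousLinearMap.adjoint μ ∘L μ
  frobenius_right :
    hmap (ContinuousLinearMap.id ℂ H) μ ∘L
        (hassoc H H H).toContinuousLinearEquiv.toContinuousLinearMap ∘L
        hmap (ContinuousLinearMap.adjoint μ) (ContinuousLinearMap.id ℂ H) =
      ContinuousLinearMap.adjoint μ ∘L μ

end Algebra

end

end HilbFrob

open scoped InnerProductSpace

namespace HilbFrob

section Tensor

variable {H K : Type*} [NormedAddCommGroup H] [InnerProductSpace ℂ H]
  [NormedAddCommGroup K] [InnerProductSpace ℂ K]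

/-! Pairing the Frobenius identity at `u ⊗ z` with `v ⊗ w` gives `M_u†(vw) = (M_u† v)w`; with
commutativity, `M_u†` then commutes with every `M_v`, in particular with `M_u`, which is normality.
For the radical, `u ∈ J` is quasi-regular: `y - yu = u` for some `y`, so `1 + M_y` inverts `1 -
M_u`. Scaling `u` removes every nonzero number from the spectrum of `M_u`; a normal operator with
spectral radius `0` vanishes, so `u` annihilates `H`. -/

theorem inner_htmul (a c : H) (b d : K) :
    ⟪htmul a b, htmul c d⟫_ℂ = ⟪a, c⟫_ℂ * ⟪b, d⟫_ℂ := by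
  simp [htmul]

/-- Bounded linear maps on a Hilbertian tensor product agree if they agree on elementary
tensors. -/
theorem htensor_ext {E : Type*} [NormedAddCommGroup E] [NormedSpace ℂ E]
    {f g : HTensor H K →L[ℂ] E} (h : ∀ x y, f (htmul x y) = g (htmul x y)) : f = g := by
  ext t
  induction t using UniformSpace.Completion.induction_on with
  | hp => exact isClosed_eq f.continuous g.continuous
  | ih t =>
    induction t using TensorProduct.induction_on with
    | zero => rw [UniformSpace.Completion.coe_zero, map_zero, map_zero]
    | tmul x y => exact h x y
    | add a b ha hb => rw [UniformSpace.Completion.coe_add, map_add, map_add, ha, hb]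

/-- Tensoring with a fixed vector on the left, as a bounded linear map. -/
noncomputable def htmulLeft (u : H) : K →L[ℂ] HTensor H K :=
  UniformSpace.Completion.toComplL ∘L TensorProduct.mkL ℂ H K u

theorem htmulLeft_apply (u : H) (x : K) : htmulLeft u x = htmul u x := rfl

theorem hassoc_symm_htmul {L : Type*} [NormedAddCommGroup L] [InnerProductSpace ℂ L]
    (x : H) (y : K) (z : L) :
    (hassoc H K L).symm (htmul x (htmul y z)) = htmul (htmul x y) z := by
  rw [LinearIsometryEquiv.symm_apply_eq, hassoc_htmul]

end Tensor

section Algebra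

variable {H : Type*} [NormedAddCommGroup H] [InnerProductSpace ℂ H] {μ : HTensor H H →L[ℂ] H}

theorem IsHilbertianAlgebra.mulOp_comm (hμ : IsHilbertianAlgebra μ) (u v : H) :
    mulOp μ u v = mulOp μ v u := by
  have h := DFunLike.congr_fun hμ.comm (htmul u v)
  rw [ContinuousLinearMap.comp_apply, hswap_htmul] at h
  exact h.symm

theorem IsHilbertianAlgebra.mulOp_mulOp (hμ : IsHilbertianAlgebra μ) (u v w : H) :
    mulOp μ (mulOp μ u v) w = mulOp μ u (mulOp μ v w) := by
  have h := DFunLike.congr_fun hμ.assoc (htmul (htmul u v) w)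
  simpa [hmap_htmul, hassoc_htmul, mulOp_apply] using h

variable [CompleteSpace H]

/-- The adjoint of a multiplication operator is a multiplier. -/
theorem IsHilbertianFrobeniusAlgebra.adjoint_mulOp_mul (hμ : IsHilbertianFrobeniusAlgebra μ)
    (u v w : H) :
    ContinuousLinearMap.adjoint (mulOp μ u) (mulOp μ v w) =
      mulOp μ (ContinuousLinearMap.adjoint (mulOp μ u) v) w := by
  refine ext_inner_right ℂ fun z => ?_
  -- Stated for an arbitrary second tensor factor, because `μ† z` need not be elementary;
  -- boundedness reduces the check to elementary tensors.
  have key : innerSL ℂ (htmul v w) ∘L hmap μ (ContinuousLinearMap.id ℂ H) ∘L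
      (hassoc H H H).symm.toContinuousLinearEquiv.toContinuousLinearMap ∘L htmulLeft u =
      innerSL ℂ (htmul (ContinuousLinearMap.adjoint (mulOp μ u) v) w) := by
    refine htensor_ext fun x y => ?_
    simp [htmulLeft_apply, hassoc_symm_htmul, hmap_htmul, inner_htmul,
      ContinuousLinearMap.adjoint_inner_left, mulOp_apply]
  have hF := DFunLike.congr_fun hμ.frobenius_left (htmul u z)
  simp only [ContinuousLinearMap.comp_apply, hmap_htmul, ContinuousLinearMap.id_apply] at hF
  have hk := DFunLike.congr_fun key (ContinuousLinearMap.adjoint μ z)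
  simp only [ContinuousLinearMap.comp_apply, htmulLeft_apply, innerSL_apply_apply] at hk
  rw [hF, ContinuousLinearMap.adjoint_inner_right, ContinuousLinearMap.adjoint_inner_right] at hk
  rw [ContinuousLinearMap.adjoint_inner_left]
  exact hk

/-- Both sides at `w` equal `(M_u† w)v`, by the multiplier property and commutativity. -/
theorem IsHilbertianFrobeniusAlgebra.commute_adjoint_mulOp (hμ : IsHilbertianFrobeniusAlgebra μ)
    (u v : H) :
    mulOp μ v ∘L ContinuousLinearMap.adjoint (mulOp μ u) =
      ContinuousLinearMap.adjoint (mulOp μ u) ∘L mulOp μ v := by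
  ext w
  rw [ContinuousLinearMap.comp_apply, ContinuousLinearMap.comp_apply, hμ.mulOp_comm v w,
    hμ.adjoint_mulOp_mul, hμ.mulOp_comm]

end Algebra

section Radical

variable {A : Type*} [AddCommGroup A] [Module ℂ A]

/-- A modular left ideal which misses its modular unit is contained in a maximal modular left
ideal which misses it. -/
theorem exists_isMaximalModularLeftIdeal (m : A →ₗ[ℂ] A →ₗ[ℂ] A) {I : Submodule ℂ A} {e : A}
    (hI : IsLeftIdeal m I) (he : ∀ x, x - m x e ∈ I) (heI : e ∉ I) :
    ∃ M, IsMaximalModularLeftIdeal m M ∧ e ∉ M := by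
  -- For left ideals above `I`, omitting `e` is the same as being proper, and it passes to unions of
  -- chains.
  obtain ⟨M, hIM, hM⟩ := zorn_le_nonempty₀ {J : Submodule ℂ A | IsLeftIdeal m J ∧ I ≤ J ∧ e ∉ J}
    (by
      intro c hc hchain J hJ
      have hmem : ∀ x, x ∈ sSup c ↔ ∃ K ∈ c, x ∈ K := fun x =>
        Submodule.mem_sSup_of_directed ⟨J, hJ⟩ hchain.directedOn
      refine ⟨sSup c, ⟨fun a x hx => ?_, (hc hJ).2.1.trans (le_sSup hJ), fun h => ?_⟩,
        fun K hK => le_sSup hK⟩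
      · obtain ⟨K, hK, hxK⟩ := (hmem x).1 hx
        exact (hmem _).2 ⟨K, hK, (hc hK).1 a x hxK⟩
      · obtain ⟨K, hK, heK⟩ := (hmem e).1 h
        exact (hc hK).2.2 heK)
    I ⟨hI, le_rfl, heI⟩
  refine ⟨M, ⟨⟨hM.prop.1, e, fun x => hIM (he x)⟩, ?_, fun J hJ hMJ hJtop => ?_⟩, hM.prop.2.2⟩
  · rintro rfl
    exact hM.prop.2.2 trivial
  · refine le_antisymm (hM.le_of_ge ⟨hJ, hIM.trans hMJ, fun heJ => hJtop ?_⟩ hMJ) hMJ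
    -- `x = (x - xe) + xe`, with both terms in `J`.
    refine eq_top_iff.2 fun x _ => ?_
    simpa using J.add_mem (hMJ (hIM (he x))) (hJ x e heJ)

/-- Elements of the Jacobson radical are quasi-regular. -/
theorem exists_sub_mul_eq_of_mem_jacobsonRadical (m : A →ₗ[ℂ] A →ₗ[ℂ] A)
    (hassoc : ∀ a b c, m (m a b) c = m a (m b c)) {u : A} (hu : u ∈ jacobsonRadical m) :
    ∃ y, y - m y u = u := by
  by_contra hy
  -- The left ideal `{x - xu}` has `u` as modular unit by construction.
  obtain ⟨M, hM, huM⟩ := exists_isMaximalModularLeftIdeal m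
    (I := LinearMap.range (LinearMap.id - m.flip u)) (e := u)
    (by
      rintro a _ ⟨x, rfl⟩
      exact ⟨m a x, by simp [hassoc]⟩)
    (fun x => ⟨x, by simp⟩)
    (by
      rintro ⟨y, h⟩
      exact hy ⟨y, by simpa using h⟩)
  exact huM ((Submodule.mem_sInf.1 hu) M hM)

/-- Modularity alone suffices: `ue = 0`, so `u = u - ue ∈ I`. -/
theorem annihilator_le_jacobsonRadical (m : A →ₗ[ℂ] A →ₗ[ℂ] A) :
    annihilator m ≤ jacobsonRadical m := by
  refine fun u hu => Submodule.mem_sInf.2 fun I hI => ?_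
  obtain ⟨e, he⟩ := hI.1.2
  simpa [show m u e = 0 from hu e] using he u

end Radical

section Algebra

variable {H : Type*} [NormedAddCommGroup H] [InnerProductSpace ℂ H] {μ : HTensor H H →L[ℂ] H}

/-- The identity minus multiplication by a radical element is invertible. -/
theorem IsHilbertianAlgebra.isUnit_one_sub_mulOp (hμ : IsHilbertianAlgebra μ) {u : H}
    (hu : u ∈ jacobsonRadical (mulBil μ)) : IsUnit (1 - mulOp μ u) := by
  obtain ⟨y, hy⟩ := exists_sub_mul_eq_of_mem_jacobsonRadical (mulBil μ) hμ.mulOp_mulOp hu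
  have hy' : y - mulOp μ y u = u := hy
  have hcomm : Commute (mulOp μ u) (mulOp μ y) := by
    ext w
    change mulOp μ u (mulOp μ y w) = mulOp μ y (mulOp μ u w)
    rw [← hμ.mulOp_mulOp, hμ.mulOp_comm u y, hμ.mulOp_mulOp]
  have hmul : mulOp μ y - mulOp μ y * mulOp μ u = mulOp μ u := by
    ext w
    change mulOp μ y w - mulOp μ y (mulOp μ u w) = mulOp μ u w
    rw [← hμ.mulOp_mulOp, ← sub_apply, ← map_sub, hy']
  have hleft : (1 + mulOp μ y) * (1 - mulOp μ u) = 1 := by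
    calc (1 + mulOp μ y) * (1 - mulOp μ u)
        = 1 + (mulOp μ y - mulOp μ y * mulOp μ u) - mulOp μ u := by noncomm_ring
      _ = 1 := by rw [hmul]; abel
  have hright : (1 - mulOp μ u) * (1 + mulOp μ y) = 1 := by
    exact ((Commute.one_left _).sub_left ((Commute.one_right _).add_right hcomm)).eq.trans hleft
  exact ⟨⟨_, _, hright, hleft⟩, rfl⟩

/-- Multiplication by a radical element is quasi-nilpotent. -/
theorem IsHilbertianAlgebra.spectralRadius_mulOp_eq_zero (hμ : IsHilbertianAlgebra μ) {u : H}
    (hu : u ∈ jacobsonRadical (mulBil μ)) : spectralRadius ℂ (mulOp μ u) = 0 := by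
  rw [spectralRadius, ← le_zero_iff]
  refine iSup₂_le fun k hk => ?_
  by_contra hk0
  have hk0 : k ≠ 0 := by
    rintro rfl
    simp at hk0
  refine hk ?_
  -- `k - M_u = k(1 - M_{k⁻¹u})`, and `k⁻¹u` stays in the radical.
  have h := hμ.isUnit_one_sub_mulOp ((jacobsonRadical (mulBil μ)).smul_mem k⁻¹ hu)
  rw [map_smul] at h
  have := (IsUnit.mk0 k hk0).map (algebraMap ℂ (H →L[ℂ] H)) |>.mul h
  rwa [mul_sub, mul_one, ← Algebra.smul_def, smul_smul, mul_inv_cancel₀ hk0, one_smul] at this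

end Algebra

end HilbFrob

theorem mainTheorem2 {H : Type*} [NormedAddCommGroup H] [InnerProductSpace ℂ H] [CompleteSpace H]
    (μ : HilbFrob.HTensor H H →L[ℂ] H) (hμ : HilbFrob.IsHilbertianFrobeniusAlgebra μ) :
    (∀ u : H,
      HilbFrob.mulOp μ u ∘L ContinuousLinearMap.adjoint (HilbFrob.mulOp μ u) =
        ContinuousLinearMap.adjoint (HilbFrob.mulOp μ u) ∘L HilbFrob.mulOp μ u) ∧
    HilbFrob.jacobsonRadical (HilbFrob.mulBil μ) =
      HilbFrob.annihilator (HilbFrob.mulBil μ) := by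
  refine ⟨fun u => hμ.commute_adjoint_mulOp u u,
    le_antisymm (fun u hu => ?_) (HilbFrob.annihilator_le_jacobsonRadical _)⟩
  have : IsStarNormal (HilbFrob.mulOp μ u) := ⟨(hμ.commute_adjoint_mulOp u u).symm⟩
  -- Normality enters the second claim here: it makes the norm equal to the spectral radius.
  have h := IsStarNormal.spectralRadius_eq_nnnorm (HilbFrob.mulOp μ u)
  rw [hμ.spectralRadius_mulOp_eq_zero hu] at h
  have h0 : HilbFrob.mulOp μ u = 0 := by simpa using h.symm
  exact fun v => DFunLike.congr_fun h0 v
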